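/- Let $\Phi\in\mathbb{R}[x,y,z]$ be homogeneous of degree three, and let $\mathcal{C}_{\mathbb R}=\{(x:y:z)\in\mathbb{P}^2(\mathbb{R}) : \Phi(x,y,z)=0\}$. Suppose that the real cubic curve $\mathcal{C}_{\mathbb R}$ is smooth and irreducible, in the sense that it contains no singular point (a point of $\mathcal{C}_{\mathbb R}$ at which $\Phi_x,\Phi_y,\Phi_z$ all vanish) and contains no line of $\mathbb{P}^2(\mathbb{R})$. A flex point of $\mathcal{C}_{\mathbb R}$ is a non-singular point of $\mathcal{C}_{\mathbb R}$ at which the intersection multiplicity of the curve with its tangent line is at least three. Let $\mathrm{Aut}(\mathbb{P}^2(\mathbb{R}),\mathcal{C}_{\mathbb R})$ be the group of all projective automorphisms of $\mathbb{P}^2(\mathbb{R})$, that is, elements of $\mathrm{PGL}(3,\mathbb{R})$, which map $\mathcal{C}_{\mathbb R}$ onto itself. Then $\mathcal{C}_{\mathbb R}$ has exactly three flex points, and the group $\mathrm{Aut}(\mathbb{P}^2(\mathbb{R}),\mathcal{C}_{\mathbb R})$ is non-abelian of order six. Its elements permute the flex points, and this action is an isomorphism of $\mathrm{Aut}(\mathbb{P}^2(\mathbb{R}),\mathcal{C}_{\mathbb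 R})$ onto the group of all permutations of the three flex points. That is, every permutation of the flex points extends to one and only one element of $\mathrm{Aut}(\mathbb{P}^2(\mathbb{R}),\mathcal{C}_{\mathbb R})$. -/

import Mathlib

open scoped LinearAlgebra.Projectivization MatrixGroups Pointwise

noncomputable section

namespace PlaneCurve

variable {K : Type*} [Field K]

/-- The curve `Φ = 0` in the projective plane over `K`, as a set of `K`-points. For homogeneous
`Φ` the condition does not depend on the representative of the point. -/
def locus (Φ : MvPolynomial (Fin 3) K) : Set (ℙ K (Fin 3 → K)) :=
  {p | MvPolynomial.eval p.rep Φ = 0}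

/-- The vector of partial derivatives of `Φ` at `v`. -/
def grad (Φ : MvPolynomial (Fin 3) K) (v : Fin 3 → K) : Fin 3 → K :=
  fun i => MvPolynomial.eval v (MvPolynomial.pderiv i Φ)

/-- The set of points of the projective plane satisfying `a₀ x + a₁ y + a₂ z = 0`.
It is a line when `a ≠ 0`. -/
def line (a : Fin 3 → K) : Set (ℙ K (Fin 3 → K)) :=
  {p | a ⬝ᵥ p.rep = 0}

/-- `p` is a singular point of the curve `Φ = 0`. -/
def IsSingularPoint (Φ : MvPolynomial (Fin 3) K) (p : ℙ K (Fin 3 → K)) : Prop :=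
  p ∈ locus Φ ∧ grad Φ p.rep = 0

/-- The locus `Φ = 0` in the projective plane over `K` contains no singular point and no line. -/
def IsSmoothIrreducible (Φ : MvPolynomial (Fin 3) K) : Prop :=
  (∀ p, ¬ IsSingularPoint Φ p) ∧ ∀ a : Fin 3 → K, a ≠ 0 → ¬ line a ⊆ locus Φ

/-- For `p ≠ q`, the intersection multiplicity at `p` of the curve `Φ = 0` with the line through
`p` and `q`: the order of vanishing at `t = 0` of the polynomial `Φ(p + t q)` in `t`
(it is `⊤` if this polynomial is zero). -/
def intersectionMultiplicity (Φ : MvPolynomial (Fin 3) K) (p q : ℙ K (Fin 3 → K)) : ℕ∞ :=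
  emultiplicity (Polynomial.X : Polynomial K)
    (MvPolynomial.aeval
      (fun i => Polynomial.C (p.rep i) + Polynomial.C (q.rep i) * Polynomial.X) Φ)

/-- The flex points of the curve `Φ = 0`: the non-singular points `p` at which the intersection
multiplicity of the curve with its tangent line is at least three. The tangent line at `p` is
`line (grad Φ p.rep)`, and it is the line through `p` and `q` for every point `q ≠ p` on it. -/
def flexPoints (Φ : MvPolynomial (Fin 3) K) : Set (ℙ K (Fin 3 → K)) :=
  {p | p ∈ locus Φ ∧ grad Φ p.rep ≠ 0 ∧
    ∀ q ∈ line (grad Φ p.rep), q ≠ p → 3 ≤ intersectionMultiplicity Φ p q}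

/-- The group of projective automorphisms of the projective plane over `K` that map the set `S`
onto itself. -/
def projAut (S : Set (ℙ K (Fin 3 → K))) : Subgroup PGL(Fin 3, K) :=
  MulAction.stabilizer PGL(Fin 3, K) S

end PlaneCurve

end

/-! The nine complex flexes give an odd-degree real equation, so a smooth real cubic has a real
flex. With it at infinity the curve is y² = P(x), and the largest real root t of 2PP'' - P'² gives
P(t) > 0, hence two further real flexes (t, ±√P(t)). In terms of the tangents u, v, w at these three
collinear flexes and the line m = 0 through them, the equation becomes uvw = m³ with u + v + w = km
(`flexForm`).

On this form everything is visible. A flex with m ≠ 0 would satisfy (u-v)² + (v-w)² + (w-u)² = 0,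
which over ℝ leads to a singular point, so there are exactly three flexes. Permutations of u, v, w
realise all permutations of the flexes. An automorphism fixing the three flexes is trivial, because
a real number has only one real cube root. This needs the passage from point sets to equations: a
cubic form vanishing on the real curve is a multiple of its equation
(`IsCubicForm.eq_const_mul_flexForm`), proved along a branch at a flex. -/

noncomputable section

namespace PlaneCurve

/-! ### Cubic forms as functions, polars and linear equivalence. -/

/-- The ternary cubic form with the given coefficients. -/
def cubicForm (c : Fin 10 → ℝ) (v : Fin 3 → ℝ) : ℝ :=
  c 0 * v 0 ^ 3 + c 1 * v 1 ^ 3 + c 2 * v 2 ^ 3 + c 3 * v 0 ^ 2 * v 1 + c 4 * v 0 ^ 2 * v 2 +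
    c 5 * v 1 ^ 2 * v 0 + c 6 * v 1 ^ 2 * v 2 + c 7 * v 2 ^ 2 * v 0 + c 8 * v 2 ^ 2 * v 1 +
    c 9 * v 0 * v 1 * v 2

/-- A function given by a ternary cubic form. -/
def IsCubicForm (φ : (Fin 3 → ℝ) → ℝ) : Prop := ∃ c, φ = cubicForm c

/-- For a cubic form `φ`, the coefficient of `t` in `φ (p + t q)`. -/
def polar (φ : (Fin 3 → ℝ) → ℝ) (p q : Fin 3 → ℝ) : ℝ :=
  (φ (p + q) - φ (p - q)) / 2 - φ q

/-- `p` represents a flex point of the cubic `φ = 0`. -/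
def IsFlexVector (φ : (Fin 3 → ℝ) → ℝ) (p : Fin 3 → ℝ) : Prop :=
  φ p = 0 ∧ (∃ q, polar φ p q ≠ 0) ∧ ∀ q, polar φ p q = 0 → polar φ q p = 0

/-- The cubic `φ = 0` has no singular point. -/
def IsSmoothForm (φ : (Fin 3 → ℝ) → ℝ) : Prop :=
  ∀ p, p ≠ 0 → φ p = 0 → ∃ q, polar φ p q ≠ 0

/-- `φ` and `ψ` agree up to a scalar factor and a linear change of coordinates. -/
def LinearlyEquivalent (φ ψ : (Fin 3 → ℝ) → ℝ) : Prop :=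
  ∃ A : GL (Fin 3) ℝ, ∃ s : ℝ, s ≠ 0 ∧ ∀ v, φ (A • v) = s * ψ v

theorem vec3_eta (v : Fin 3 → ℝ) : v = ![v 0, v 1, v 2] := by
  ext i; fin_cases i <;> rfl

theorem forall_vec3 {P : (Fin 3 → ℝ) → Prop} (h : ∀ x y z, P ![x, y, z]) (v : Fin 3 → ℝ) : P v := by
  rw [vec3_eta v]; exact h _ _ _

theorem smul_vec3 (A : GL (Fin 3) ℝ) (x y z : ℝ) :
    A • ![x, y, z] = ![A 0 0 * x + A 0 1 * y + A 0 2 * z, A 1 0 * x + A 1 1 * y + A 1 2 * z,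
      A 2 0 * x + A 2 1 * y + A 2 2 * z] := by
  change A.1.mulVec _ = _
  ext i; fin_cases i <;> simp [Matrix.mulVec, dotProduct, Fin.sum_univ_three]

theorem polar_vec3 (φ : (Fin 3 → ℝ) → ℝ) (a b c d e f : ℝ) :
    polar φ ![a, b, c] ![d, e, f] =
      (φ ![a + d, b + e, c + f] - φ ![a - d, b - e, c - f]) / 2 - φ ![d, e, f] := by
  simp [polar]

namespace IsCubicForm

theorem add {φ ψ : (Fin 3 → ℝ) → ℝ} (hφ : IsCubicForm φ) (hψ : IsCubicForm ψ) :
    IsCubicForm (fun v => φ v + ψ v) := by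
  obtain ⟨c, rfl⟩ := hφ
  obtain ⟨d, rfl⟩ := hψ
  exact ⟨c + d, by ext v; simp only [cubicForm, Pi.add_apply]; ring⟩

theorem const_mul {φ : (Fin 3 → ℝ) → ℝ} (s : ℝ) (hφ : IsCubicForm φ) :
    IsCubicForm (fun v => s * φ v) := by
  obtain ⟨c, rfl⟩ := hφ
  exact ⟨s • c, by ext v; simp only [cubicForm, Pi.smul_apply, smul_eq_mul]; ring⟩

theorem prod (a b c : Fin 3 → ℝ) :
    IsCubicForm (fun v => (a 0 * v 0 + a 1 * v 1 + a 2 * v 2) *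
      (b 0 * v 0 + b 1 * v 1 + b 2 * v 2) * (c 0 * v 0 + c 1 * v 1 + c 2 * v 2)) := by
  refine ⟨![a 0 * b 0 * c 0, a 1 * b 1 * c 1, a 2 * b 2 * c 2,
    a 0 * b 0 * c 1 + a 0 * b 1 * c 0 + a 1 * b 0 * c 0,
    a 0 * b 0 * c 2 + a 0 * b 2 * c 0 + a 2 * b 0 * c 0,
    a 1 * b 1 * c 0 + a 1 * b 0 * c 1 + a 0 * b 1 * c 1,
    a 1 * b 1 * c 2 + a 1 * b 2 * c 1 + a 2 * b 1 * c 1,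
    a 2 * b 2 * c 0 + a 2 * b 0 * c 2 + a 0 * b 2 * c 2,
    a 2 * b 2 * c 1 + a 2 * b 1 * c 2 + a 1 * b 2 * c 2,
    a 0 * b 1 * c 2 + a 0 * b 2 * c 1 + a 1 * b 0 * c 2 + a 1 * b 2 * c 0 +
      a 2 * b 0 * c 1 + a 2 * b 1 * c 0], ?_⟩
  ext v
  simp [cubicForm]
  ring

theorem comp {φ : (Fin 3 → ℝ) → ℝ} (hφ : IsCubicForm φ) (A : GL (Fin 3) ℝ) :
    IsCubicForm (fun v => φ (A • v)) := by
  obtain ⟨c, rfl⟩ := hφ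
  have h (i : Fin 10) (a b d : Fin 3) := const_mul (c i) (prod (A a) (A b) (A d))
  have := (((((((((h 0 0 0 0).add (h 1 1 1 1)).add (h 2 2 2 2)).add (h 3 0 0 1)).add
    (h 4 0 0 2)).add (h 5 1 1 0)).add (h 6 1 1 2)).add (h 7 2 2 0)).add (h 8 2 2 1)).add (h 9 0 1 2)
  convert this using 1
  ext v
  rw [vec3_eta v, smul_vec3]
  simp [cubicForm]
  ring

theorem map_smul {φ : (Fin 3 → ℝ) → ℝ} (hφ : IsCubicForm φ) (t : ℝ) (p : Fin 3 → ℝ) :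
    φ (t • p) = t ^ 3 * φ p := by
  obtain ⟨c, rfl⟩ := hφ
  simp [cubicForm]; ring

theorem polar_smul_left {φ : (Fin 3 → ℝ) → ℝ} (hφ : IsCubicForm φ) (t : ℝ) (p q : Fin 3 → ℝ) :
    polar φ (t • p) q = t ^ 2 * polar φ p q := by
  obtain ⟨c, rfl⟩ := hφ
  simp [cubicForm, polar]; ring

theorem polar_smul_right {φ : (Fin 3 → ℝ) → ℝ} (hφ : IsCubicForm φ) (t : ℝ) (p q : Fin 3 → ℝ) :
    polar φ p (t • q) = t * polar φ p q := by
  obtain ⟨c, rfl⟩ := hφ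
  simp [cubicForm, polar]; ring

theorem polar_self {φ : (Fin 3 → ℝ) → ℝ} (hφ : IsCubicForm φ) (p : Fin 3 → ℝ) :
    polar φ p p = 3 * φ p := by
  obtain ⟨c, rfl⟩ := hφ
  simp [cubicForm, polar]; ring

theorem polar_eq_sum {φ : (Fin 3 → ℝ) → ℝ} (hφ : IsCubicForm φ) (p q : Fin 3 → ℝ) :
    polar φ p q = polar φ p ![1, 0, 0] * q 0 + polar φ p ![0, 1, 0] * q 1 +
      polar φ p ![0, 0, 1] * q 2 := by
  obtain ⟨c, rfl⟩ := hφ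
  simp [cubicForm, polar]; ring

end IsCubicForm

/-- `polar` uses only values of the form, so changing coordinates needs no chain rule. -/
theorem polar_comp {φ ψ : (Fin 3 → ℝ) → ℝ} {A : GL (Fin 3) ℝ} {s : ℝ}
    (h : ∀ v, φ (A • v) = s * ψ v) (p q : Fin 3 → ℝ) :
    polar φ (A • p) (A • q) = s * polar ψ p q := by
  simp only [polar, ← smul_add, ← smul_sub, h]
  ring

theorem IsSmoothForm.of_comp {φ ψ : (Fin 3 → ℝ) → ℝ} (hφ : IsSmoothForm φ) {A : GL (Fin 3) ℝ}
    {s : ℝ} (h : ∀ v, φ (A • v) = s * ψ v) : IsSmoothForm ψ := by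
  intro p hp h0
  obtain ⟨q, hq⟩ := hφ (A • p) ((smul_ne_zero_iff_ne A).2 hp) (by simp [h, h0])
  rw [← smul_inv_smul A q, polar_comp h] at hq
  exact ⟨_, right_ne_zero_of_mul hq⟩

theorem isFlexVector_smul_iff {φ ψ : (Fin 3 → ℝ) → ℝ} {A : GL (Fin 3) ℝ} {s : ℝ} (hs : s ≠ 0)
    (h : ∀ v, φ (A • v) = s * ψ v) (p : Fin 3 → ℝ) :
    IsFlexVector φ (A • p) ↔ IsFlexVector ψ p := by
  have e1 (q) : polar φ (A • p) q = s * polar ψ p (A⁻¹ • q) := by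
    rw [← polar_comp h, smul_inv_smul]
  have e2 (q) : polar φ q (A • p) = s * polar ψ (A⁻¹ • q) p := by
    rw [← polar_comp h, smul_inv_smul]
  simp only [IsFlexVector, h, e1, e2, mul_eq_zero, hs, false_or, ne_eq]
  refine and_congr_right fun _ => and_congr ⟨?_, ?_⟩ ⟨?_, ?_⟩
  · rintro ⟨q, hq⟩; exact ⟨_, hq⟩
  · rintro ⟨q, hq⟩; exact ⟨A • q, by simpa using hq⟩
  · intro H q; simpa using H (A • q)
  · intro H q; exact H _

theorem isFlexVector_real_smul_iff {φ : (Fin 3 → ℝ) → ℝ} (hφ : IsCubicForm φ) {t : ℝ} (ht : t ≠ 0)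
    (p : Fin 3 → ℝ) : IsFlexVector φ (t • p) ↔ IsFlexVector φ p := by
  simp [IsFlexVector, hφ.map_smul, hφ.polar_smul_left, hφ.polar_smul_right, ht]

namespace LinearlyEquivalent

theorem trans {φ ψ χ : (Fin 3 → ℝ) → ℝ} (h₁ : LinearlyEquivalent φ ψ)
    (h₂ : LinearlyEquivalent ψ χ) : LinearlyEquivalent φ χ := by
  obtain ⟨A, s, hs, hA⟩ := h₁
  obtain ⟨B, t, ht, hB⟩ := h₂
  exact ⟨A * B, s * t, mul_ne_zero hs ht, fun v => by rw [mul_smul, hA, hB, mul_assoc]⟩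

theorem isSmoothForm {φ ψ : (Fin 3 → ℝ) → ℝ} (h : LinearlyEquivalent φ ψ) (hφ : IsSmoothForm φ) :
    IsSmoothForm ψ := by
  obtain ⟨A, s, -, hA⟩ := h
  exact hφ.of_comp hA

theorem exists_isFlexVector {φ ψ : (Fin 3 → ℝ) → ℝ} (h : LinearlyEquivalent φ ψ)
    (hψ : ∃ p, p ≠ 0 ∧ IsFlexVector ψ p) : ∃ p, p ≠ 0 ∧ IsFlexVector φ p := by
  obtain ⟨A, s, hs, hA⟩ := h
  obtain ⟨p, hp, hf⟩ := hψ
  exact ⟨A • p, (smul_ne_zero_iff_ne A).2 hp, (isFlexVector_smul_iff hs hA p).2 hf⟩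

theorem of_det_ne_zero {φ ψ : (Fin 3 → ℝ) → ℝ} (a b c d e f g h i : ℝ)
    (hdet : !![a, b, c; d, e, f; g, h, i].det ≠ 0) {s : ℝ} (hs : s ≠ 0)
    (H : ∀ x y z, φ ![a * x + b * y + c * z, d * x + e * y + f * z, g * x + h * y + i * z] =
      s * ψ ![x, y, z]) : LinearlyEquivalent φ ψ := by
  refine ⟨Matrix.GeneralLinearGroup.mkOfDetNeZero _ hdet, s, hs, forall_vec3 fun x y z => ?_⟩
  rw [← H, smul_vec3]
  rfl

end LinearlyEquivalent

/-! ### Existence of a real flex. -/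

/-- Coordinates in which a given nonsingular point is `(0 : 1 : 0)`, with tangent `z = 0`. -/
theorem exists_frame {φ : (Fin 3 → ℝ) → ℝ} (hφ : IsCubicForm φ) {p : Fin 3 → ℝ} (h0 : φ p = 0)
    (hp : ∃ q, polar φ p q ≠ 0) :
    ∃ (A : GL (Fin 3) ℝ) (l q1 q2 q3 c0 c1 c2 c3 : ℝ), l ≠ 0 ∧ A • ![0, 1, 0] = p ∧
      ∀ x y z, φ (A • ![x, y, z]) = l * y ^ 2 * z + y * (q1 * x ^ 2 + q2 * x * z + q3 * z ^ 2) +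
        (c0 * x ^ 3 + c1 * x ^ 2 * z + c2 * x * z ^ 2 + c3 * z ^ 3) := by
  set a : Fin 3 → ℝ := ![polar φ p ![1, 0, 0], polar φ p ![0, 1, 0], polar φ p ![0, 0, 1]] with ha
  have hpol (q) : polar φ p q = a 0 * q 0 + a 1 * q 1 + a 2 * q 2 := hφ.polar_eq_sum p q
  have hpa : a 0 * p 0 + a 1 * p 1 + a 2 * p 2 = 0 := by
    rw [← hpol, hφ.polar_self, h0, mul_zero]
  have ha2 : 0 < a 0 ^ 2 + a 1 ^ 2 + a 2 ^ 2 := by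
    by_contra hle
    obtain ⟨q, hq⟩ := hp
    apply hq
    have h0 : a 0 = 0 := by nlinarith [sq_nonneg (a 0), sq_nonneg (a 1), sq_nonneg (a 2)]
    have h1 : a 1 = 0 := by nlinarith [sq_nonneg (a 0), sq_nonneg (a 1), sq_nonneg (a 2)]
    have h2 : a 2 = 0 := by nlinarith [sq_nonneg (a 0), sq_nonneg (a 1), sq_nonneg (a 2)]
    rw [hpol, h0, h1, h2]; ring
  have hp2 : 0 < p 0 ^ 2 + p 1 ^ 2 + p 2 ^ 2 := by
    by_contra hle
    have h0 : p 0 = 0 := by nlinarith [sq_nonneg (p 0), sq_nonneg (p 1), sq_nonneg (p 2)]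
    have h1 : p 1 = 0 := by nlinarith [sq_nonneg (p 0), sq_nonneg (p 1), sq_nonneg (p 2)]
    have h2 : p 2 = 0 := by nlinarith [sq_nonneg (p 0), sq_nonneg (p 1), sq_nonneg (p 2)]
    obtain ⟨q, hq⟩ := hp
    apply hq
    have : p = (0 : ℝ) • p := by rw [vec3_eta p, h0, h1, h2]; simp
    rw [this, hφ.polar_smul_left]; simp
  -- The columns are a × p, p, a, with a the gradient at p. Euler's relation gives a ⬝ p = 0, so
  -- they are mutually orthogonal; a × p and p span the tangent line, which becomes z = 0.
  have hdet : !![a 1 * p 2 - a 2 * p 1, p 0, a 0; a 2 * p 0 - a 0 * p 2, p 1, a 1;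
      a 0 * p 1 - a 1 * p 0, p 2, a 2].det ≠ 0 := by
    have : !![a 1 * p 2 - a 2 * p 1, p 0, a 0; a 2 * p 0 - a 0 * p 2, p 1, a 1;
      a 0 * p 1 - a 1 * p 0, p 2, a 2].det =
      -((a 0 ^ 2 + a 1 ^ 2 + a 2 ^ 2) * (p 0 ^ 2 + p 1 ^ 2 + p 2 ^ 2)) +
        (a 0 * p 0 + a 1 * p 1 + a 2 * p 2) ^ 2 := by
      rw [Matrix.det_fin_three]; simp; ring
    rw [this, hpa]
    have := mul_pos ha2 hp2
    simp only [ne_eq, OfNat.ofNat_ne_zero, not_false_eq_true, zero_pow, add_zero, neg_eq_zero]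
    exact this.ne'
  set A : GL (Fin 3) ℝ := Matrix.GeneralLinearGroup.mkOfDetNeZero _ hdet with hA
  have hAv (x y z : ℝ) : A • ![x, y, z] =
      ![(a 1 * p 2 - a 2 * p 1) * x + p 0 * y + a 0 * z,
        (a 2 * p 0 - a 0 * p 2) * x + p 1 * y + a 1 * z,
        (a 0 * p 1 - a 1 * p 0) * x + p 2 * y + a 2 * z] := smul_vec3 A x y z
  have hAp : A • ![0, 1, 0] = p := by
    rw [hAv]; ext i; fin_cases i <;> simp
  obtain ⟨c, hc⟩ := hφ.comp A
  have hc' (v) : φ (A • v) = 1 * cubicForm c v := by rw [one_mul, ← hc]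
  have h1 : c 1 = 0 := by
    have := hc' ![0, 1, 0]
    rw [hAp, h0] at this
    simpa [cubicForm] using this.symm
  have h5 : c 5 = 0 := by
    have := polar_comp hc' ![0, 1, 0] ![1, 0, 0]
    rw [hAp, hpol, hAv] at this
    simp [polar, cubicForm] at this
    linarith
  have h6 : c 6 = a 0 ^ 2 + a 1 ^ 2 + a 2 ^ 2 := by
    have := polar_comp hc' ![0, 1, 0] ![0, 0, 1]
    rw [hAp, hpol, hAv] at this
    simp [polar, cubicForm] at this
    linarith
  refine ⟨A, c 6, c 3, c 9, c 8, c 0, c 4, c 7, c 2, h6 ▸ ha2.ne', hAp, fun x y z => ?_⟩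
  rw [hc']
  simp [cubicForm, h1, h5]
  ring

theorem exists_eval_eq_zero_of_odd_natDegree {P : Polynomial ℝ} (hP : Odd P.natDegree) :
    ∃ x, P.eval x = 0 := by
  wlog hl : 0 < P.leadingCoeff generalizing P
  · have hne : P.leadingCoeff ≠ 0 := by
      rw [Polynomial.leadingCoeff_ne_zero]; rintro rfl; simp at hP
    obtain ⟨x, hx⟩ := this (P := -P) (by simpa using hP)
      (by simpa using lt_of_le_of_ne (not_lt.1 hl) hne)
    exact ⟨x, by simpa using hx⟩
  have hd : 0 < P.natDegree := hP.pos
  have htop := P.tendsto_atTop_of_leadingCoeff_nonneg (Polynomial.natDegree_pos_iff_degree_pos.1 hd)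
    hl.le
  have hbot : Filter.Tendsto (fun x => (P.comp (-Polynomial.X)).eval x) .atTop .atBot := by
    apply Polynomial.tendsto_atBot_of_leadingCoeff_nonpos
    · rw [← Polynomial.natDegree_pos_iff_degree_pos, Polynomial.natDegree_comp]; simpa using hd
    · rw [Polynomial.leadingCoeff_comp (by simp)]
      simp [hP.neg_one_pow, hl.le]
  have hbot' := hbot.comp Filter.tendsto_neg_atBot_atTop
  refine P.continuous.surjective htop ?_ 0
  convert hbot' using 2 with x
  simp

/-- A real cubic curve has a real point. -/
theorem IsCubicForm.exists_zero {φ : (Fin 3 → ℝ) → ℝ} (hφ : IsCubicForm φ) :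
    ∃ p, p ≠ 0 ∧ φ p = 0 := by
  obtain ⟨c, rfl⟩ := hφ
  by_cases h0 : c 0 = 0
  · exact ⟨![1, 0, 0], by simp, by simp [cubicForm, h0]⟩
  · let P : Polynomial ℝ := .C (c 0) * .X ^ 3 + .C (c 3) * .X ^ 2 + .C (c 5) * .X + .C (c 1)
    have hP : P.natDegree = 3 := Polynomial.natDegree_cubic h0
    obtain ⟨x, hx⟩ := exists_eval_eq_zero_of_odd_natDegree (P := P) (by rw [hP]; decide)
    refine ⟨![x, 1, 0], fun h => by simpa using congrFun h 1, ?_⟩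
    simp [P] at hx
    simp [cubicForm]
    linarith

/-- Flexes of `tangentForm` on z = 1: the curve is a quadratic in y with discriminant s², and the
second equation is the flex condition. Eliminating s leaves an equation of degree 9 in x, which has
a real root. -/
theorem exists_sq_eq_and_cube_eq (q : ℝ) {c : ℝ} (hc : c ≠ 0) (d : ℝ) :
    ∃ x s : ℝ, s ^ 2 = (x ^ 2 + q) ^ 2 - 4 * c * x - 4 * d ∧
      s ^ 3 = s ^ 2 * (3 * x ^ 2 + q) - 2 * (x * (x ^ 2 + q) - c) ^ 2 := by
  -- With D = s² and T the right side of the cubic condition, D = w² - l and T = w³ - 2wl + r. Hence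
  -- T² - D³ = u - w⁴l, where deg u ≤ 8 and w⁴l has degree 9 because c ≠ 0.
  let w : Polynomial ℝ := .X ^ 2 + .C q
  let l : Polynomial ℝ := .C (4 * c) * .X + .C (4 * d)
  let r : Polynomial ℝ := .C (-4 * d) * w + .C (2 * q) * l + .C (-2 * c ^ 2)
  let u : Polynomial ℝ := w ^ 2 * l ^ 2 + l ^ 3 + .C 2 * r * w ^ 3 - .C 4 * r * w * l + r ^ 2
  have hw : w.natDegree = 2 := Polynomial.natDegree_X_pow_add_C
  have hl : l.natDegree = 1 := Polynomial.natDegree_linear (by simpa using hc)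
  have hw' : w.natDegree ≤ 2 := hw.le
  have hl' : l.natDegree ≤ 1 := hl.le
  have hr : r.natDegree ≤ 2 := by
    simp only [r]; compute_degree
    omega
  have hu : u.natDegree ≤ 8 := by
    simp only [u]; compute_degree
    omega
  have hwl : (w ^ 4 * l).natDegree = 9 := by
    rw [Polynomial.natDegree_mul, Polynomial.natDegree_pow, hw, hl]
    · apply pow_ne_zero; intro h; simp [h] at hw
    · intro h; simp [h] at hl
  have hdeg : (u - w ^ 4 * l).natDegree = 9 := by
    rw [Polynomial.natDegree_sub_eq_right_of_natDegree_lt (by rw [hwl]; omega), hwl]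
  obtain ⟨x, hx⟩ := exists_eval_eq_zero_of_odd_natDegree (P := u - w ^ 4 * l)
    (by rw [hdeg]; decide)
  set D := (x ^ 2 + q) ^ 2 - 4 * c * x - 4 * d with hD
  set T := D * (3 * x ^ 2 + q) - 2 * (x * (x ^ 2 + q) - c) ^ 2 with hT
  have hTD : T ^ 2 = D ^ 3 := by
    simp [u, r, w, l] at hx
    rw [hT, hD]
    linear_combination hx
  by_cases h0 : D = 0
  · have hT0 : T = 0 := by simpa [h0] using hTD
    refine ⟨x, 0, by simp [← hD, h0], ?_⟩
    rw [hT, h0] at hT0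
    linear_combination -hT0
  -- Taking s = T/D selects the square root of D with the sign for which s³ = T.
  · have h2 : (T / D) ^ 2 = D := by field_simp; linarith
    refine ⟨x, T / D, h2, ?_⟩
    rw [h2, ← hT, pow_succ, h2]
    field_simp

/-- The function `y² z + x² y + q y z² + c x z² + d z³`. -/
def tangentForm (q c d : ℝ) (v : Fin 3 → ℝ) : ℝ :=
  v 1 ^ 2 * v 2 + v 0 ^ 2 * v 1 + q * v 1 * v 2 ^ 2 + c * v 0 * v 2 ^ 2 + d * v 2 ^ 3

theorem exists_isFlexVector_tangentForm (q c d : ℝ) (h : IsSmoothForm (tangentForm q c d)) :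
    ∃ p, p ≠ 0 ∧ IsFlexVector (tangentForm q c d) p := by
  by_cases hc : c = 0
  -- For c = 0 the tangent y = 0 at (1 : 0 : 0) meets the curve in d z³ = 0.
  · refine ⟨![1, 0, 0], by simp, by simp [tangentForm], ⟨![0, 1, 0], ?_⟩, forall_vec3 fun a b e => ?_⟩
    · simp [polar, tangentForm]
    · simp [polar, tangentForm, hc]
      intro hb
      have : b = 0 := by linear_combination hb
      subst this; ring
  obtain ⟨x, s, h2, h3⟩ := exists_sq_eq_and_cube_eq q hc d
  have hp : ![x, (s - x ^ 2 - q) / 2, 1] ≠ 0 := fun h => by simpa using congrFun h 2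
  have h0 : tangentForm q c d ![x, (s - x ^ 2 - q) / 2, 1] = 0 := by
    simp [tangentForm]; linear_combination h2 / 4
  have hpol (a b e : ℝ) : polar (tangentForm q c d) ![x, (s - x ^ 2 - q) / 2, 1] ![a, b, e] =
      (x * (s - x ^ 2 - q) + c) * (a - e * x) + s * (b - e * (s - x ^ 2 - q) / 2) := by
    simp [polar, tangentForm]; linear_combination (3 / 4 * e) * h2
  have hpol' (a b e : ℝ) : polar (tangentForm q c d) ![a, b, e] ![x, (s - x ^ 2 - q) / 2, 1] =
      (b - e * (s - x ^ 2 - q) / 2) ^ 2 + (a - e * x) ^ 2 * ((s - x ^ 2 - q) / 2) +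
      2 * x * (a - e * x) * (b - e * (s - x ^ 2 - q) / 2) + 2 * e *
      ((x * (s - x ^ 2 - q) + c) * (a - e * x) + s * (b - e * (s - x ^ 2 - q) / 2)) := by
    simp [polar, tangentForm]; linear_combination (3 / 4 * e ^ 2) * h2
  -- Here s is the y-derivative at the point; if it vanished, `h3` would make the x-derivative
  -- vanish too.
  have hs : s ≠ 0 := by
    rintro rfl
    obtain ⟨v, hv⟩ := h _ hp h0
    apply hv
    rw [vec3_eta v, hpol]
    have : x * (x ^ 2 + q) - c = 0 := by
      have : (x * (x ^ 2 + q) - c) ^ 2 = 0 := by linear_combination h3 / 2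
      exact pow_eq_zero_iff (two_ne_zero) |>.1 this
    linear_combination (-(v 0 - v 2 * x)) * this
  refine ⟨_, hp, h0, h _ hp h0, forall_vec3 fun a b e => ?_⟩
  rw [hpol, hpol']
  -- Modulo the point itself, a direction on the tangent has only the two coordinates a', b'.
  generalize b - e * (s - x ^ 2 - q) / 2 = b'
  generalize a - e * x = a'
  intro hab
  have hb : b' = -(x * (s - x ^ 2 - q) + c) * a' / s := by field_simp; linear_combination hab
  rw [hab, hb]
  field_simp
  linear_combination a' ^ 2 * h3

theorem linearlyEquivalent_tangentForm {ψ : (Fin 3 → ℝ) → ℝ} {l q1 q2 q3 c0 c1 c2 c3 : ℝ}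
    (hl : l ≠ 0) (hq : q1 ≠ 0)
    (h : ∀ x y z, ψ ![x, y, z] = l * y ^ 2 * z + y * (q1 * x ^ 2 + q2 * x * z + q3 * z ^ 2) +
        (c0 * x ^ 3 + c1 * x ^ 2 * z + c2 * x * z ^ 2 + c3 * z ^ 3)) :
    ∃ q c d, LinearlyEquivalent ψ (tangentForm q c d) := by
  -- Scaling normalises y²z and x²y; the shears that follow remove x³ (shifting y by x), xyz
  -- (shifting x by z) and x²z (shifting y by z).
  have S1 : ∃ q2' q3' c0' c1' c2' c3' : ℝ, LinearlyEquivalent ψ (fun v => v 1 ^ 2 * v 2 +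
      v 1 * (v 0 ^ 2 + q2' * v 0 * v 2 + q3' * v 2 ^ 2) +
        (c0' * v 0 ^ 3 + c1' * v 0 ^ 2 * v 2 + c2' * v 0 * v 2 ^ 2 + c3' * v 2 ^ 3)) := by
    have hs : q1 ^ 2 / l ≠ 0 := by positivity
    refine ⟨q2 / q1, q3 / q1, c0 * l / q1 ^ 2, c1 * l / q1 ^ 2, c2 * l / q1 ^ 2, c3 * l / q1 ^ 2,
      .of_det_ne_zero 1 0 0 0 (q1 / l) 0 0 0 1
      (by rw [Matrix.det_fin_three]; simp [hl, hq]) hs fun x y z => ?_⟩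
    rw [h]
    simp
    field_simp
  obtain ⟨q2, q3, c0, c1, c2, c3, e1⟩ := S1
  have S2 : ∃ q2' q3' c1' c2' c3' : ℝ, LinearlyEquivalent ψ (fun v => v 1 ^ 2 * v 2 +
      v 1 * (v 0 ^ 2 + q2' * v 0 * v 2 + q3' * v 2 ^ 2) +
        (c1' * v 0 ^ 2 * v 2 + c2' * v 0 * v 2 ^ 2 + c3' * v 2 ^ 3)) := by
    refine ⟨q2 - 2 * c0, q3, c1 + c0 ^ 2 - q2 * c0, c2 - q3 * c0, c3, e1.trans
      (.of_det_ne_zero 1 0 0 (-c0) 1 0 0 0 1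
      (by rw [Matrix.det_fin_three]; simp) one_ne_zero fun x y z => ?_)⟩
    simp
    ring
  obtain ⟨q2, q3, c1, c2, c3, e2⟩ := S2
  have S3 : ∃ q3' c1' c2' c3' : ℝ, LinearlyEquivalent ψ (fun v => v 1 ^ 2 * v 2 +
      v 1 * (v 0 ^ 2 + q3' * v 2 ^ 2) +
        (c1' * v 0 ^ 2 * v 2 + c2' * v 0 * v 2 ^ 2 + c3' * v 2 ^ 3)) := by
    refine ⟨q3 - q2 ^ 2 / 4, c1, c2 - c1 * q2, c3 + c1 * q2 ^ 2 / 4 - c2 * q2 / 2, e2.trans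
      (.of_det_ne_zero 1 0 (-q2 / 2) 0 1 0 0 0 1
      (by rw [Matrix.det_fin_three]; simp) one_ne_zero fun x y z => ?_)⟩
    simp
    ring
  obtain ⟨q3, c1, c2, c3, e3⟩ := S3
  refine ⟨q3 - 2 * c1, c2, c3 + c1 ^ 2 - q3 * c1, e3.trans
      (.of_det_ne_zero 1 0 0 0 1 (-c1) 0 0 1
      (by rw [Matrix.det_fin_three]; simp) one_ne_zero fun x y z => ?_)⟩
  simp [tangentForm]
  ring

/-- A smooth real cubic curve has a real flex point. -/
theorem IsCubicForm.exists_isFlexVector {φ : (Fin 3 → ℝ) → ℝ} (hφ : IsCubicForm φ)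
    (hs : IsSmoothForm φ) : ∃ p, p ≠ 0 ∧ IsFlexVector φ p := by
  obtain ⟨p, hp, h0⟩ := hφ.exists_zero
  obtain ⟨A, l, q1, q2, q3, c0, c1, c2, c3, hl, hA, h⟩ := exists_frame hφ h0 (hs p hp h0)
  have e : LinearlyEquivalent φ (fun v => φ (A • v)) := ⟨A, 1, one_ne_zero, fun v => (one_mul _).symm⟩
  refine e.exists_isFlexVector ?_
  -- On the tangent z = 0 the form is q1 x²y + c0 x³, so q1 = 0 means that the chosen point is
  -- already a flex.
  by_cases hq : q1 = 0
  · refine ⟨![0, 1, 0], fun h => by simpa using congrFun h 1, by simp [h], ⟨![0, 0, 1], ?_⟩,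
      forall_vec3 fun a b d => ?_⟩
    · rw [polar_vec3]; simp only [h]; ring_nf; exact hl
    · rw [polar_vec3, polar_vec3]
      simp only [h, hq]
      intro hd
      have : d = 0 := by
        apply (mul_eq_zero.1 (show l * d = 0 by linear_combination hd)).resolve_left hl
      subst this; ring
  · obtain ⟨q, c, d, e'⟩ := linearlyEquivalent_tangentForm (ψ := fun v => φ (A • v)) hl hq h
    exact e'.exists_isFlexVector
      (exists_isFlexVector_tangentForm q c d (e'.isSmoothForm (e.isSmoothForm hs)))

/-! ### Reduction to the normal form uvw = m³. -/

/-- The function `u v (k m - u - v) - m³`, whose flex points are its zeros on the line `m = 0`. -/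
def flexForm (k : ℝ) (v : Fin 3 → ℝ) : ℝ :=
  v 0 * v 1 * (k * v 2 - v 0 - v 1) - v 2 ^ 3

/-- The function `y² z - (x³ + a x² z + b x z² + c z³)`. -/
def weierstrassForm (a b c : ℝ) (v : Fin 3 → ℝ) : ℝ :=
  v 1 ^ 2 * v 2 - (v 0 ^ 3 + a * v 0 ^ 2 * v 2 + b * v 0 * v 2 ^ 2 + c * v 2 ^ 3)

/-- With P the cubic, the equation is P'² = 2PP'', the flex condition on y² = P(x); P(t) > 0 makes
the flex real and affine. -/
theorem exists_sq_eq_four_mul_of_cubic (a b c : ℝ)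
    (h : ∀ x, x ^ 3 + a * x ^ 2 + b * x + c = 0 → 3 * x ^ 2 + 2 * a * x + b ≠ 0) :
    ∃ t, 0 < t ^ 3 + a * t ^ 2 + b * t + c ∧
      (3 * t ^ 2 + 2 * a * t + b) ^ 2 = 4 * (3 * t + a) * (t ^ 3 + a * t ^ 2 + b * t + c) := by
  let P : Polynomial ℝ := .C 1 * .X ^ 3 + .C a * .X ^ 2 + .C b * .X + .C c
  have hP : P.natDegree = 3 := Polynomial.natDegree_cubic one_ne_zero
  have hPe (x) : P.eval x = x ^ 3 + a * x ^ 2 + b * x + c := by simp [P]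
  have hPtop : Filter.Tendsto (fun x => P.eval x) .atTop .atTop :=
    P.tendsto_atTop_of_leadingCoeff_nonneg
      (Polynomial.natDegree_pos_iff_degree_pos.1 (by rw [hP]; norm_num))
      (by rw [Polynomial.leadingCoeff_cubic one_ne_zero]; norm_num)
  -- Q = 2PP'' - P'², so Q = -P'² ≤ 0 at every root of P.
  let Q : Polynomial ℝ := .C 3 * .X ^ 4 +
    (.C (4 * a) * .X ^ 3 + .C (6 * b) * .X ^ 2 + .C (12 * c) * .X + .C (4 * a * c - b ^ 2))
  have hQd : Q.natDegree = 4 := by simp only [Q]; compute_degree!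
  have hQl : Q.leadingCoeff = 3 := by
    rw [Polynomial.leadingCoeff, hQd]; 
    simp only [Q, Polynomial.coeff_add, Polynomial.coeff_C_mul, Polynomial.coeff_X_pow,
      Polynomial.coeff_X, Polynomial.coeff_C]
    norm_num
  have hQe (x) : Q.eval x = 4 * (3 * x + a) * (x ^ 3 + a * x ^ 2 + b * x + c) -
      (3 * x ^ 2 + 2 * a * x + b) ^ 2 := by simp [Q]; ring
  have hQtop : Filter.Tendsto (fun x => Q.eval x) .atTop .atTop :=
    Q.tendsto_atTop_of_leadingCoeff_nonneg
      (Polynomial.natDegree_pos_iff_degree_pos.1 (by rw [hQd]; norm_num)) (by rw [hQl]; norm_num)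
  set S : Set ℝ := {x | Q.eval x ≤ 0} with hS
  have hSc : IsClosed S := isClosed_le Q.continuous continuous_const
  have hroot (e : ℝ) (he : P.eval e = 0) : e ∈ S := by
    rw [hPe] at he
    simp only [hS, Set.mem_ofPred_eq, hQe, he]
    nlinarith [sq_nonneg (3 * e ^ 2 + 2 * a * e + b)]
  obtain ⟨e, he⟩ := exists_eval_eq_zero_of_odd_natDegree (P := P) (by rw [hP]; decide)
  have hSb : BddAbove S := by
    obtain ⟨M, hM⟩ := (hQtop.eventually_gt_atTop 0).exists_forall_of_atTop
    exact ⟨M, fun x hx => not_lt.1 fun hlt => (hM x hlt.le).not_ge hx⟩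
  have htS : sSup S ∈ S := hSc.csSup_mem ⟨e, hroot e he⟩ hSb
  set t := sSup S with ht
  have hbeyond (x : ℝ) (hx : t < x) : 0 < Q.eval x :=
    not_le.1 fun hle => hx.not_ge (le_csSup hSb hle)
  have hQt : Q.eval t = 0 := by
    refine le_antisymm htS ?_
    have hc : Filter.Tendsto (fun x => Q.eval x) (nhdsWithin t (Set.Ioi t)) (nhds (Q.eval t)) :=
      Q.continuous.continuousAt.mono_left nhdsWithin_le_nhds
    exact ge_of_tendsto hc (by filter_upwards [self_mem_nhdsWithin] with x hx using (hbeyond x hx).le)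
  -- If P(t) < 0, then P has a root beyond t, which would lie in S.
  have hPt : 0 ≤ P.eval t := by
    by_contra! hlt
    obtain ⟨M, hM⟩ := (hPtop.eventually_gt_atTop 0).exists_forall_of_atTop
    obtain ⟨x, hx, hx0⟩ := intermediate_value_Icc (le_max_left t M) P.continuous.continuousOn
      ⟨hlt.le, (hM _ (le_max_right t M)).le⟩
    have : x = t := le_antisymm (le_csSup hSb (hroot x hx0)) hx.1
    simp only [this] at hx0
    linarith
  rw [hQe] at hQt
  rw [hPe] at hPt
  refine ⟨t, lt_of_le_of_ne hPt fun h0 => h t h0.symm ?_, by linarith⟩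
  rw [← h0] at hQt
  have : (3 * t ^ 2 + 2 * a * t + b) ^ 2 = 0 := by linarith
  exact pow_eq_zero_iff two_ne_zero |>.1 this

/-- Let L = d z + e(x - t z), so that y = L is the tangent at the flex (t, d). Triple contact turns
the equation into (y - L)(y + L)z = (x - t z)³. -/
theorem exists_linearlyEquivalent_flexForm_of_weierstrassForm (a b c : ℝ)
    (h : IsSmoothForm (weierstrassForm a b c)) :
    ∃ k, LinearlyEquivalent (weierstrassForm a b c) (flexForm k) := by
  obtain ⟨t, ht, ht2⟩ := exists_sq_eq_four_mul_of_cubic a b c fun x hx hx' => by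
    obtain ⟨v, hv⟩ := h ![x, 0, 1] (fun h => by simpa using congrFun h 2)
      (by simp [weierstrassForm]; linear_combination -hx)
    apply hv
    rw [vec3_eta v]
    simp [polar, weierstrassForm]
    linear_combination (-3 * v 2) * hx - (v 0 - x * v 2) * hx'
  obtain ⟨d, hd, hd2⟩ : ∃ d : ℝ, 0 < d ∧ d ^ 2 = t ^ 3 + a * t ^ 2 + b * t + c :=
    ⟨_, Real.sqrt_pos.2 ht, Real.sq_sqrt ht.le⟩
  obtain ⟨r, hr, hr3⟩ : ∃ r : ℝ, r ≠ 0 ∧ r ^ 3 * (2 * d) = 1 := by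
    refine ⟨(1 / (2 * d)) ^ ((3 : ℕ) : ℝ)⁻¹, by positivity, ?_⟩
    rw [Real.rpow_inv_natCast_pow (by positivity) (by norm_num)]
    field_simp
  obtain ⟨e, he⟩ : ∃ e, e * (2 * d) = 3 * t ^ 2 + 2 * a * t + b :=
    ⟨(3 * t ^ 2 + 2 * a * t + b) / (2 * d), by field_simp⟩
  have he2 : e ^ 2 = 3 * t + a := by
    rw [← hd2, ← he] at ht2
    have hd4 : 4 * d ^ 2 ≠ 0 := by positivity
    apply mul_left_cancel₀ hd4
    linear_combination ht2
  have ha : a = e ^ 2 - 3 * t := by linarith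
  have hb : b = e * (2 * d) - 3 * t ^ 2 - 2 * a * t := by linarith
  have hc : c = d ^ 2 - t ^ 3 - a * t ^ 2 - b * t := by linarith
  -- This inverts z = r³u, y - L = v, y + L = -w, x - t z = -r m, where w = k m - u - v; the
  -- condition r³·2d = 1 gives u coefficient one in y + L.
  refine ⟨2 * e * r, .of_det_ne_zero (t * r ^ 3) 0 (-r) (1 / 2) 1 (-e * r) (r ^ 3) 0 0
    (s := - r ^ 3) ?_ (by simpa using hr) fun x y z => ?_⟩
  · rw [Matrix.det_fin_three]; simp [hr]
  · simp [weierstrassForm, flexForm]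
    subst hc hb ha
    have hd' : d = 1 / (2 * r ^ 3) := by field_simp; linarith
    subst hd'
    field_simp
    ring

/-- A smooth real cubic curve without lines is projectively equivalent to
`u v (k m - u - v) = m³` for some `k`. -/
theorem IsCubicForm.exists_linearlyEquivalent_flexForm {φ : (Fin 3 → ℝ) → ℝ} (hφ : IsCubicForm φ)
    (hs : IsSmoothForm φ)
    (hl : ∀ a : Fin 3 → ℝ, a ≠ 0 → ∃ v, a ⬝ᵥ v = 0 ∧ φ v ≠ 0) :
    ∃ k, LinearlyEquivalent φ (flexForm k) := by
  obtain ⟨p, -, h0, hq, hf⟩ := hφ.exists_isFlexVector hs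
  obtain ⟨A, l, q1, q2, q3, c0, c1, c2, c3, hl0, rfl, h⟩ := exists_frame hφ h0 hq
  have e : LinearlyEquivalent φ (fun v => φ (A • v)) := ⟨A, 1, one_ne_zero, fun v => (one_mul _).symm⟩
  have hq1 : q1 = 0 := by
    have hA := polar_comp (φ := φ) (ψ := fun v => φ (A • v)) (A := A) (s := 1)
      (fun v => (one_mul _).symm)
    have := hf (A • ![1, 0, 0]) (by rw [hA, polar_vec3]; simp only [h]; ring)
    rw [hA, polar_vec3] at this
    simp only [h] at this
    linear_combination this
  subst hq1
  -- Now z = 0 meets the curve in c0 x³ = 0. Smoothness at real points alone would not exclude c0 =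
  -- 0: a line and a conic may have no common real point.
  have hc0 : c0 ≠ 0 := by
    rintro rfl
    have hz (v : Fin 3 → ℝ) : (A⁻¹ • v) 2 =
        ![A⁻¹ 2 0, A⁻¹ 2 1, A⁻¹ 2 2] ⬝ᵥ v := by
      conv_lhs => rw [vec3_eta v, smul_vec3]
      simp [dotProduct, Fin.sum_univ_three]
    obtain ⟨v, hv, hv0⟩ := hl ![A⁻¹ 2 0, A⁻¹ 2 1, A⁻¹ 2 2] (fun h0 => by
      have := hz (A • ![0, 0, 1])
      rw [h0] at this
      simp at this)
    apply hv0
    rw [← smul_inv_smul A v, vec3_eta (A⁻¹ • v), h, hz, hv]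
    ring
  obtain ⟨a, b, c, e'⟩ : ∃ a b c, LinearlyEquivalent φ (weierstrassForm a b c) := by
    have e2 : ∃ b1 b2 c1 c2 c3, LinearlyEquivalent φ (fun v =>
        v 1 ^ 2 * v 2 + v 1 * (b1 * v 0 * v 2 + b2 * v 2 ^ 2) -
        (v 0 ^ 3 + c1 * v 0 ^ 2 * v 2 + c2 * v 0 * v 2 ^ 2 + c3 * v 2 ^ 3)) := by
      refine ⟨q2 / l, -q3 * c0 / l ^ 2, -c1 / l, c2 * c0 / l ^ 2, -c3 * c0 ^ 2 / l ^ 3, e.trans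
        (.of_det_ne_zero 1 0 0 0 1 0 0 0 (-c0 / l) (s := -c0) ?_ (by simpa using hc0)
        fun x y z => ?_)⟩
      · rw [Matrix.det_fin_three]; simp [hc0, hl0]
      · rw [h]; simp; field_simp; ring
    obtain ⟨b1, b2, c1, c2, c3, e2⟩ := e2
    refine ⟨c1 + b1 ^ 2 / 4, c2 + b1 * b2 / 2, c3 + b2 ^ 2 / 4, e2.trans
        (.of_det_ne_zero 1 0 0 (-b1 / 2) 1 (-b2 / 2) 0 0 1 ?_ one_ne_zero fun x y z => ?_)⟩
    · rw [Matrix.det_fin_three]; simp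
    · simp [weierstrassForm]; ring
  obtain ⟨k, e3⟩ :=
    exists_linearlyEquivalent_flexForm_of_weierstrassForm a b c (e'.isSmoothForm hs)
  exact ⟨k, e'.trans e3⟩

/-! ### Flexes of the normal form. -/

/-- Representatives of the flex points of `u v (k m - u - v) = m³`. -/
def flexVector : Fin 3 → Fin 3 → ℝ := ![![1, 0, 0], ![0, 1, 0], ![1, -1, 0]]

theorem flexVector_ne_zero (i : Fin 3) : flexVector i ≠ 0 := by
  intro h
  fin_cases i
  · simpa [flexVector] using congrFun h 0
  · simpa [flexVector] using congrFun h 1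
  · simpa [flexVector] using congrFun h 0

theorem flexVector_eq_of_smul_eq {i j : Fin 3} {t : ℝ} (h : t • flexVector i = flexVector j) :
    i = j := by
  have h0 := congrFun h 0
  have h1 := congrFun h 1
  fin_cases i <;> fin_cases j <;> simp [flexVector] at h0 h1 ⊢
  · linarith
  · linarith

theorem polar_flexForm (k a b c d e f : ℝ) :
    polar (flexForm k) ![a, b, c] ![d, e, f] = d * b * (k * c - 2 * a - b) +
      e * a * (k * c - a - 2 * b) + f * (k * a * b - 3 * c ^ 2) := by
  rw [polar_vec3]; simp [flexForm]; ring

theorem isFlexVector_flexVector (k : ℝ) (i : Fin 3) : IsFlexVector (flexForm k) (flexVector i) := by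
  fin_cases i
  · refine ⟨by simp [flexVector, flexForm], ⟨![0, 1, 0], ?_⟩, forall_vec3 fun a b c => ?_⟩
    · simp [flexVector, polar_flexForm]
    · simp [flexVector, polar_flexForm]; rintro rfl; simp
  · refine ⟨by simp [flexVector, flexForm], ⟨![1, 0, 0], ?_⟩, forall_vec3 fun a b c => ?_⟩
    · simp [flexVector, polar_flexForm]
    · simp [flexVector, polar_flexForm]; rintro rfl; simp
  · refine ⟨by simp [flexVector, flexForm], ⟨![1, 0, 0], ?_⟩, forall_vec3 fun a b c => ?_⟩
    · norm_num [flexVector, polar_flexForm]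
    · simp [flexVector, polar_flexForm]
      intro h
      have : k * c = a + b := by linarith
      rw [this]; ring

theorem IsFlexVector.exists_smul_flexVector {k : ℝ} {p : Fin 3 → ℝ}
    (h : IsFlexVector (flexForm k) p) :
    ∃ i, ∃ t : ℝ, t • flexVector i = p := by
  obtain ⟨u, v, m, rfl⟩ : ∃ u v m, p = ![u, v, m] := ⟨_, _, _, vec3_eta p⟩
  obtain ⟨h0, ⟨q, hq⟩, hf⟩ := h
  have h0' : u * v * (k * m - u - v) = m ^ 3 := by simpa [flexForm, sub_eq_zero] using h0
  obtain ⟨w, hw⟩ : ∃ w, w = k * m - u - v := ⟨_, rfl⟩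
  rw [← hw] at h0'
  have hm : m = 0 := by
    by_contra hm
    have huvw : u * v * w ≠ 0 := by rw [h0']; positivity
    have hu : u ≠ 0 := fun h => huvw (by simp [h])
    have hv : v ≠ 0 := fun h => huvw (by simp [h])
    have hkm : k * m = u + v + w := by linarith
    -- A tangent direction with zero m-coordinate; its second-order term is, up to a factor, uvw
    -- times a sum of squares.
    have hd := hf ![u * (v - w), v * (w - u), 0] (by
      rw [polar_flexForm, hkm]; ring)
    rw [polar_flexForm] at hd
    have hd' : u * v * w * ((u - v) ^ 2 + (v - w) ^ 2 + (w - u) ^ 2) = 0 := by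
      linear_combination (-2) * hd + 2 * u * v * (v - w) * (w - u) * hkm
    have hsum := (mul_eq_zero.1 hd').resolve_left huvw
    have huv : u = v := by nlinarith [sq_nonneg (u - v), sq_nonneg (v - w), sq_nonneg (w - u)]
    have hvw : v = w := by nlinarith [sq_nonneg (u - v), sq_nonneg (v - w), sq_nonneg (w - u)]
    subst huv hvw
    apply hq
    rw [vec3_eta q, polar_flexForm]
    -- At u = v = w all partial derivatives vanish, contradicting nonsingularity.
    have hm' : m * (k * u * u - 3 * m ^ 2) = 0 := by linear_combination u ^ 2 * hkm + 3 * h0'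
    rw [(mul_eq_zero.1 hm').resolve_left hm, hkm]
    ring
  subst hm
  have : u * v * (u + v) = 0 := by rw [hw] at h0'; linear_combination -h0'
  rcases mul_eq_zero.1 this with h | h
  · rcases mul_eq_zero.1 h with rfl | rfl
    · exact ⟨1, v, by simp [flexVector]⟩
    · exact ⟨0, u, by simp [flexVector]⟩
  · exact ⟨2, u, by simp [flexVector]; linarith⟩

/-! ### Cubic forms vanishing on the real curve. -/

open Filter Topology in
-- Letting m → 0 gives a = 0, and then m can be cancelled. Iteration compares coefficients without
-- any differentiability of g or F.
theorem eq_zero_of_eventually_add_mul_eq_zero {a : ℝ} {g F : ℝ → ℝ} (hg : ContinuousAt g 0)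
    (hg0 : g 0 ≠ 0) (hF : ContinuousAt F 0) (h : ∀ᶠ m in 𝓝[≠] 0, a * g m + m * F m = 0) :
    a = 0 ∧ ∀ᶠ m in 𝓝[≠] 0, F m = 0 := by
  have hc : ContinuousAt (fun m => a * g m + m * F m) 0 :=
    (continuousAt_const.mul hg).add (continuousAt_id.mul hF)
  have h0 : a * g 0 + 0 * F 0 = 0 :=
    tendsto_nhds_unique (hc.tendsto.mono_left nhdsWithin_le_nhds)
      ((tendsto_congr' h).2 tendsto_const_nhds)
  have ha : a = 0 := by simpa [hg0] using h0
  refine ⟨ha, ?_⟩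
  filter_upwards [h, self_mem_nhdsWithin] with m hm hm0
  simpa [ha, show m ≠ 0 from hm0] using hm

open Filter Topology in
theorem eq_zero_of_eventually_const_add_mul_eq_zero {a : ℝ} {F : ℝ → ℝ}
    (h : ∀ᶠ m in 𝓝[≠] 0, a + m * F m = 0) (hF : ContinuousAt F 0) :
    a = 0 ∧ ∀ᶠ m in 𝓝[≠] 0, F m = 0 :=
  eq_zero_of_eventually_add_mul_eq_zero (g := fun _ => 1) continuousAt_const one_ne_zero hF
    (by simpa using h)

open Filter Topology in
/-- Near the flex point `(1 : 0 : 0)`, the curve `u v (k m - u - v) = m³` has the parametrization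
`v = m³ h(m)`. -/
theorem exists_local_parametrization_flexForm (k : ℝ) :
    ∃ h : ℝ → ℝ, ContinuousAt h 0 ∧ h 0 ≠ 0 ∧
      ∀ᶠ m in 𝓝 0, flexForm k ![1, m ^ 3 * h m, m] = 0 := by
  -- The small root of v² + (1 - k m)v + m³ = 0, with the square root moved to the denominator so
  -- that m³ factors out.
  refine ⟨fun m => -2 / ((1 - k * m) + √((1 - k * m) ^ 2 - 4 * m ^ 3)), ?_, ?_, ?_⟩
  · apply ContinuousAt.div (by fun_prop) (by fun_prop)
    norm_num
  · norm_num
  · have h1 : ∀ᶠ m : ℝ in 𝓝 0, 0 < (1 - k * m) ^ 2 - 4 * m ^ 3 :=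
      (show ContinuousAt (fun m : ℝ => (1 - k * m) ^ 2 - 4 * m ^ 3) 0 by fun_prop).eventually_const_lt
        (by norm_num)
    have h2 : ∀ᶠ m : ℝ in 𝓝 0, 0 < 1 - k * m :=
      (show ContinuousAt (fun m : ℝ => 1 - k * m) 0 by fun_prop).eventually_const_lt (by norm_num)
    filter_upwards [h1, h2] with m h1 h2
    have hs := Real.sq_sqrt h1.le
    have hp := Real.sqrt_nonneg ((1 - k * m) ^ 2 - 4 * m ^ 3)
    generalize √((1 - k * m) ^ 2 - 4 * m ^ 3) = r at *
    have hr : 1 - k * m + r ≠ 0 := by positivity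
    have hi := mul_inv_cancel₀ hr
    rw [div_eq_mul_inv]
    generalize (1 - k * m + r)⁻¹ = i at *
    simp [flexForm]
    linear_combination m ^ 3 * (-i ^ 2 * hs + ((r - (1 - k * m)) * i + 1) * hi)

/-- A cubic form that vanishes on the real curve `u v (k m - u - v) = m³` is proportional to
its equation. -/
theorem IsCubicForm.eq_const_mul_flexForm {ψ : (Fin 3 → ℝ) → ℝ} (hψ : IsCubicForm ψ) {k : ℝ}
    (h : ∀ v, flexForm k v = 0 → ψ v = 0) : ∃ c, ∀ v, ψ v = c * flexForm k v := by
  obtain ⟨c, rfl⟩ := hψ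
  obtain ⟨f, hf, hf0, hloc⟩ := exists_local_parametrization_flexForm k
  have hloc' := hloc.filter_mono (nhdsWithin_le_nhds (s := {0}ᶜ))
  -- Once m³ is eliminated by the curve equation, the remaining nine monomials have distinct orders
  -- 0, ..., 7, 9 in m along the branch u = 1, v = m³h(m), so their coefficients vanish one by one.
  have s0 := eq_zero_of_eventually_add_mul_eq_zero (a := c 0) (g := fun _ => 1)
    (F := fun m => c 4 + m * (c 7 + m * ((c 3 - c 2) * f m + m * ((c 9 + k * c 2) * f m + m *
      (c 8 * f m + m * ((c 5 - c 2) * f m ^ 2 + m * (c 6 * f m ^ 2 + m * (m * (c 1 * f m ^ 3)))))))))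
    (by fun_prop) one_ne_zero (by fun_prop) (by
      filter_upwards [hloc'] with m hm
      have h1 := h _ hm
      simp [cubicForm, flexForm] at h1 hm
      linear_combination h1 + c 2 * hm)
  have s1 := eq_zero_of_eventually_const_add_mul_eq_zero s0.2 (by fun_prop)
  have s2 := eq_zero_of_eventually_const_add_mul_eq_zero s1.2 (by fun_prop)
  have s3 := eq_zero_of_eventually_add_mul_eq_zero hf hf0 (by fun_prop) s2.2
  have s4 := eq_zero_of_eventually_add_mul_eq_zero hf hf0 (by fun_prop) s3.2
  have s5 := eq_zero_of_eventually_add_mul_eq_zero hf hf0 (by fun_prop) s4.2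
  have hf2 : ContinuousAt (fun m => f m ^ 2) 0 := by fun_prop
  have hf3 : ContinuousAt (fun m => f m ^ 3) 0 := by fun_prop
  have s6 := eq_zero_of_eventually_add_mul_eq_zero hf2 (pow_ne_zero 2 hf0) (by fun_prop) s5.2
  have s7 := eq_zero_of_eventually_add_mul_eq_zero hf2 (pow_ne_zero 2 hf0) (by fun_prop) s6.2
  -- No monomial has order 8, hence the dummy coefficient 0.
  have s8 := eq_zero_of_eventually_const_add_mul_eq_zero (a := 0)
    (F := fun m => c 1 * f m ^ 3) (by simpa only [zero_add] using s7.2) (by fun_prop)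
  have s9 := eq_zero_of_eventually_add_mul_eq_zero (F := fun _ => 0) hf3 (pow_ne_zero 3 hf0)
    (a := c 1)
    (by fun_prop) (by simpa only [mul_zero, add_zero] using s8.2)
  refine ⟨-c 2, fun v => ?_⟩
  have e3 : c 3 = c 2 := by linarith [s3.1]
  have e5 : c 5 = c 2 := by linarith [s6.1]
  have e9 : c 9 = -k * c 2 := by linarith [s4.1]
  simp only [cubicForm, flexForm, s0.1, s1.1, s2.1, e3, e5, e9, s5.1, s7.1, s9.1]
  ring

/-! ### Linear automorphisms of the normal form. -/

/-- A linear map preserving the curve `u v (k m - u - v) = m³` and fixing its three flex points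
is a scalar. -/
theorem eq_smul_of_fixes_flexVector {k c : ℝ} (B : GL (Fin 3) ℝ)
    (hB : ∀ v, flexForm k (B • v) = c * flexForm k v)
    (hfix : ∀ i, ∃ t : ℝ, B • flexVector i = t • flexVector i) :
    ∃ t : ℝ, t ≠ 0 ∧ ∀ v : Fin 3 → ℝ, B • v = t • v := by
  obtain ⟨t0, h0⟩ := hfix 0
  obtain ⟨t1, h1⟩ := hfix 1
  obtain ⟨t2, h2⟩ := hfix 2
  replace h0 : B • ![(1 : ℝ), 0, 0] = t0 • ![(1 : ℝ), 0, 0] := h0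
  replace h1 : B • ![(0 : ℝ), 1, 0] = t1 • ![(0 : ℝ), 1, 0] := h1
  replace h2 : B • ![(1 : ℝ), -1, 0] = t2 • ![(1 : ℝ), -1, 0] := h2
  rw [smul_vec3] at h0 h1 h2
  have h00 := congrFun h0 0
  have h01 := congrFun h0 1
  have h02 := congrFun h0 2
  have h10 := congrFun h1 0
  have h11 := congrFun h1 1
  have h12 := congrFun h1 2
  have h20 := congrFun h2 0
  have h21 := congrFun h2 1
  simp at h00 h01 h02 h10 h11 h12 h20 h21
  have ht : t0 ≠ 0 := by
    rintro rfl
    have : B • ![(1 : ℝ), 0, 0] = 0 := by rw [smul_vec3]; simp [h00, h01, h02]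
    have := (smul_eq_zero_iff_eq B).1 this
    simp at this
  -- Fixing three points of the line m = 0 forces equal eigenvalues on it.
  have e10 : B 1 1 = t0 := by rw [h10, h00] at h20; rw [h01, h11] at h21; linarith
  set p := B 0 2
  set q := B 1 2
  set d := B 2 2
  have hv (u v m : ℝ) : (t0 * u + p * m) * (t0 * v + q * m) *
      (k * (d * m) - (t0 * u + p * m) - (t0 * v + q * m)) - (d * m) ^ 3 =
      c * (u * v * (k * m - u - v) - m ^ 3) := by
    have := hB ![u, v, m]
    rw [smul_vec3] at this
    simp [flexForm, h00, h01, h02, h10, e10, h12] at this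
    linear_combination this
  have hc : c = t0 ^ 3 := by linear_combination (hv 1 1 0) / 2
  -- A second difference in u isolates the u² coefficient.
  have hq : q = 0 := by
    have : t0 ^ 2 * q = 0 := by
      linear_combination -(hv 1 0 1) / 2 - (hv (-1) 0 1) / 2 + hv 0 0 1
    simpa [ht] using this
  have hp : p = 0 := by
    have : t0 ^ 2 * p = 0 := by
      linear_combination -(hv 0 1 1) / 2 - (hv 0 (-1) 1) / 2 + hv 0 0 1
    simpa [ht] using this
  have hd : d = t0 := by
    have h := hv 0 0 1
    rw [hp, hq, hc] at h
    have : d ^ 3 = t0 ^ 3 := by linear_combination -h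
    -- Over ℂ, d could differ from t0 by a cube root of unity.
    exact (Odd.strictMono_pow (by decide : Odd 3)).injective this
  refine ⟨t0, ht, forall_vec3 fun x y z => ?_⟩
  rw [smul_vec3]
  simp [h00, h01, h02, h10, e10, h12, show B 0 2 = 0 from hp, show B 1 2 = 0 from hq,
    show B 2 2 = t0 from hd]

theorem exists_perm_flexVector (k : ℝ) (σ : Equiv.Perm (Fin 3)) :
    ∃ B : GL (Fin 3) ℝ, (∀ v, flexForm k (B • v) = flexForm k v) ∧
      ∀ i, ∃ t : ℝ, B • flexVector i = t • flexVector (σ i) := by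
  have mul {σ τ : Equiv.Perm (Fin 3)} (hσ : ∃ B : GL (Fin 3) ℝ,
      (∀ v, flexForm k (B • v) = flexForm k v) ∧
        ∀ i, ∃ t : ℝ, B • flexVector i = t • flexVector (σ i))
      (hτ : ∃ B : GL (Fin 3) ℝ, (∀ v, flexForm k (B • v) = flexForm k v) ∧
        ∀ i, ∃ t : ℝ, B • flexVector i = t • flexVector (τ i)) :
      ∃ B : GL (Fin 3) ℝ, (∀ v, flexForm k (B • v) = flexForm k v) ∧
        ∀ i, ∃ t : ℝ, B • flexVector i = t • flexVector ((σ * τ) i) := by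
    obtain ⟨B, hB, hB'⟩ := hσ
    obtain ⟨C, hC, hC'⟩ := hτ
    refine ⟨B * C, fun v => by rw [mul_smul, hB, hC], fun i => ?_⟩
    obtain ⟨t, ht⟩ := hC' i
    obtain ⟨s, hs⟩ := hB' (τ i)
    exact ⟨t * s, by rw [mul_smul, ht, smul_comm, hs, smul_smul]; rfl⟩
  have h01 : ∃ B : GL (Fin 3) ℝ, (∀ v, flexForm k (B • v) = flexForm k v) ∧
      ∀ i, ∃ t : ℝ, B • flexVector i = t • flexVector (Equiv.swap (0 : Fin 3) 1 i) := by
    refine ⟨.mkOfDetNeZero !![0, 1, 0; 1, 0, 0; 0, 0, 1] (by rw [Matrix.det_fin_three]; simp),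
      forall_vec3 fun x y z => ?_, fun i => ?_⟩
    · rw [smul_vec3]
      simp [flexForm, Matrix.GeneralLinearGroup.mkOfDetNeZero]
      ring
    · fin_cases i
      · exact ⟨1, by simp [flexVector, smul_vec3, Matrix.GeneralLinearGroup.mkOfDetNeZero]⟩
      · exact ⟨1, by simp [flexVector, smul_vec3, Matrix.GeneralLinearGroup.mkOfDetNeZero]⟩
      · refine ⟨-1, ?_⟩
        rw [Equiv.swap_apply_of_ne_of_ne (by decide) (by decide)]
        simp [flexVector, smul_vec3, Matrix.GeneralLinearGroup.mkOfDetNeZero]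
  have h12 : ∃ B : GL (Fin 3) ℝ, (∀ v, flexForm k (B • v) = flexForm k v) ∧
      ∀ i, ∃ t : ℝ, B • flexVector i = t • flexVector (Equiv.swap (1 : Fin 3) 2 i) := by
    -- This map exchanges u with w = k m - u - v and fixes v and m.
    refine ⟨.mkOfDetNeZero !![-1, -1, k; 0, 1, 0; 0, 0, 1] (by rw [Matrix.det_fin_three]; simp),
      forall_vec3 fun x y z => ?_, fun i => ?_⟩
    · rw [smul_vec3]
      simp [flexForm, Matrix.GeneralLinearGroup.mkOfDetNeZero]
      ring
    · fin_cases i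
      · refine ⟨-1, ?_⟩
        rw [Equiv.swap_apply_of_ne_of_ne (by decide) (by decide)]
        simp [flexVector, smul_vec3, Matrix.GeneralLinearGroup.mkOfDetNeZero]
      · exact ⟨-1, by simp [flexVector, smul_vec3, Matrix.GeneralLinearGroup.mkOfDetNeZero]⟩
      · exact ⟨-1, by simp [flexVector, smul_vec3, Matrix.GeneralLinearGroup.mkOfDetNeZero]⟩
  have hall : ∀ σ : Equiv.Perm (Fin 3), σ = Equiv.swap 0 1 * Equiv.swap 0 1 ∨
      σ = Equiv.swap 0 1 ∨ σ = Equiv.swap 1 2 ∨ σ = Equiv.swap 0 1 * Equiv.swap 1 2 ∨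
      σ = Equiv.swap 1 2 * Equiv.swap 0 1 ∨
      σ = Equiv.swap 0 1 * (Equiv.swap 1 2 * Equiv.swap 0 1) := by decide
  rcases hall σ with rfl | rfl | rfl | rfl | rfl | rfl
  · exact mul h01 h01
  · exact h01
  · exact h12
  · exact mul h01 h12
  · exact mul h12 h01
  · exact mul h01 (mul h12 h01)

/-! ### From polynomials and projective points to forms and vectors. -/

open MvPolynomial in
theorem exists_eq_of_isHomogeneous_three {Φ : MvPolynomial (Fin 3) ℝ} (hΦ : Φ.IsHomogeneous 3) :
    ∃ c : Fin 10 → ℝ, Φ = C (c 0) * X 0 ^ 3 + C (c 1) * X 1 ^ 3 + C (c 2) * X 2 ^ 3 +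
      C (c 3) * (X 0 ^ 2 * X 1) + C (c 4) * (X 0 ^ 2 * X 2) + C (c 5) * (X 1 ^ 2 * X 0) +
      C (c 6) * (X 1 ^ 2 * X 2) + C (c 7) * (X 2 ^ 2 * X 0) + C (c 8) * (X 2 ^ 2 * X 1) +
      C (c 9) * (X 0 * X 1 * X 2) := by
  let P (Φ : MvPolynomial (Fin 3) ℝ) : Prop := ∃ c : Fin 10 → ℝ, Φ = C (c 0) * X 0 ^ 3 +
      C (c 1) * X 1 ^ 3 + C (c 2) * X 2 ^ 3 +
      C (c 3) * (X 0 ^ 2 * X 1) + C (c 4) * (X 0 ^ 2 * X 2) + C (c 5) * (X 1 ^ 2 * X 0) +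
      C (c 6) * (X 1 ^ 2 * X 2) + C (c 7) * (X 2 ^ 2 * X 0) + C (c 8) * (X 2 ^ 2 * X 1) +
      C (c 9) * (X 0 * X 1 * X 2)
  change P Φ
  rw [Φ.as_sum]
  refine Finset.sum_induction _ P ?_ ⟨0, by simp⟩ fun d hd => ?_
  · rintro _ _ ⟨c, rfl⟩ ⟨d, rfl⟩
    refine ⟨c + d, ?_⟩
    simp only [Pi.add_apply, map_add]
    ring
  · have hdeg : d 0 + d 1 + d 2 = 3 := by
      have := hΦ (mem_support_iff.1 hd)
      rw [Finsupp.weight_apply, Finsupp.sum_fintype _ _ (by simp)] at this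
      simpa [Fin.sum_univ_three] using this
    rw [monomial_eq, Finsupp.prod_fintype _ _ (by simp), Fin.prod_univ_three]
    generalize coeff d Φ = a
    generalize d 0 = i at *
    generalize d 1 = j at *
    generalize d 2 = k at *
    have hi : i ≤ 3 := by omega
    have hj : j ≤ 3 := by omega
    obtain rfl : k = 3 - i - j := by omega
    have key (m : Fin 10) : P (C a * ![X 0 ^ 3, X 1 ^ 3, X 2 ^ 3, X 0 ^ 2 * X 1, X 0 ^ 2 * X 2,
        X 1 ^ 2 * X 0, X 1 ^ 2 * X 2, X 2 ^ 2 * X 0, X 2 ^ 2 * X 1, X 0 * X 1 * X 2] m) := by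
      refine ⟨Pi.single m a, ?_⟩
      fin_cases m <;> simp
    interval_cases i <;> interval_cases j <;> first | omega | skip
    · simpa using key 2
    · simpa [mul_comm] using key 8
    · simpa using key 6
    · simpa using key 1
    · simpa [mul_comm] using key 7
    · simpa using key 9
    · simpa [mul_comm] using key 5
    · simpa using key 4
    · simpa using key 3
    · simpa using key 0

variable {Φ : MvPolynomial (Fin 3) ℝ}

theorem isCubicForm_eval (hΦ : Φ.IsHomogeneous 3) : IsCubicForm fun v => MvPolynomial.eval v Φ := by
  obtain ⟨c, rfl⟩ := exists_eq_of_isHomogeneous_three hΦ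
  exact ⟨c, by ext v; simp [cubicForm]; ring⟩

theorem grad_dotProduct (hΦ : Φ.IsHomogeneous 3) (p q : Fin 3 → ℝ) :
    grad Φ p ⬝ᵥ q = polar (fun v => MvPolynomial.eval v Φ) p q := by
  obtain ⟨c, rfl⟩ := exists_eq_of_isHomogeneous_three hΦ
  simp [grad, polar, dotProduct, Fin.sum_univ_three, MvPolynomial.pderiv_X, Pi.single_apply]
  ring

theorem three_le_intersectionMultiplicity_iff (hΦ : Φ.IsHomogeneous 3) (p q : ℙ ℝ (Fin 3 → ℝ)) :
    3 ≤ intersectionMultiplicity Φ p q ↔ MvPolynomial.eval p.rep Φ = 0 ∧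
      polar (fun v => MvPolynomial.eval v Φ) p.rep q.rep = 0 ∧
      polar (fun v => MvPolynomial.eval v Φ) q.rep p.rep = 0 := by
  have hP : MvPolynomial.aeval
      (fun i => Polynomial.C (p.rep i) + Polynomial.C (q.rep i) * Polynomial.X) Φ =
      Polynomial.C (MvPolynomial.eval p.rep Φ) +
      Polynomial.C (polar (fun v => MvPolynomial.eval v Φ) p.rep q.rep) * Polynomial.X +
      Polynomial.C (polar (fun v => MvPolynomial.eval v Φ) q.rep p.rep) * Polynomial.X ^ 2 +
      Polynomial.C (MvPolynomial.eval q.rep Φ) * Polynomial.X ^ 3 := by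
    obtain ⟨c, rfl⟩ := exists_eq_of_isHomogeneous_three hΦ
    apply Polynomial.funext
    intro t
    simp [polar]
    ring
  rw [intersectionMultiplicity, hP, show (3 : ℕ∞) = ((3 : ℕ) : ℕ∞) from rfl,
    ← pow_dvd_iff_le_emultiplicity, Polynomial.X_pow_dvd_iff]
  constructor
  · intro h
    have h0 := h 0 (by norm_num)
    have h1 := h 1 (by norm_num)
    have h2 := h 2 (by norm_num)
    simp only [Polynomial.coeff_add, Polynomial.coeff_C_mul, Polynomial.coeff_X_pow,
      Polynomial.coeff_X, Polynomial.coeff_C] at h0 h1 h2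
    norm_num at h0 h1 h2
    exact ⟨h0, h1, h2⟩
  · rintro ⟨h0, h1, h2⟩ d hd
    rw [h0, h1, h2]
    simp [Polynomial.coeff_X_pow, hd.ne]

theorem exists_smul_eq_rep_mk {v : Fin 3 → ℝ} (hv : v ≠ 0) :
    ∃ t : ℝ, t ≠ 0 ∧ t • v = (Projectivization.mk ℝ v hv).rep := by
  obtain ⟨a, ha⟩ := Projectivization.exists_smul_eq_mk_rep ℝ v hv
  exact ⟨a, a.ne_zero, ha⟩

theorem mk_mem_locus_iff (hΦ : Φ.IsHomogeneous 3) {v : Fin 3 → ℝ} (hv : v ≠ 0) :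
    Projectivization.mk ℝ v hv ∈ locus Φ ↔ MvPolynomial.eval v Φ = 0 := by
  obtain ⟨t, ht, h⟩ := exists_smul_eq_rep_mk hv
  rw [locus, Set.mem_ofPred_eq, ← h]
  have := (isCubicForm_eval hΦ).map_smul t v
  simp [this, ht]

theorem mem_flexPoints_iff (hΦ : Φ.IsHomogeneous 3) (p : ℙ ℝ (Fin 3 → ℝ)) :
    p ∈ flexPoints Φ ↔ IsFlexVector (fun v => MvPolynomial.eval v Φ) p.rep := by
  have hC := isCubicForm_eval hΦ
  rw [flexPoints, Set.mem_ofPred_eq, IsFlexVector]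
  refine and_congr_right fun h0 => and_congr ?_ ?_
  · simp only [← grad_dotProduct hΦ]
    rw [← not_iff_not]
    push Not
    rw [dotProduct_eq_zero_iff]
  · constructor
    · intro H q hq
      -- The vector condition also covers q = 0 and multiples of p, which are not points q ≠ p;
      -- there it holds by homogeneity and Euler's relation.
      by_cases hq0 : q = 0
      · have := hC.polar_smul_left 0 q p.rep
        subst hq0; simpa using this
      obtain ⟨t, ht, h⟩ := exists_smul_eq_rep_mk hq0
      by_cases hqp : Projectivization.mk ℝ q hq0 = p
      · rw [hqp] at h
        have h1 : q = t⁻¹ • p.rep := by rw [← h, smul_smul, inv_mul_cancel₀ ht, one_smul]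
        rw [h1, hC.polar_smul_left, hC.polar_self, show MvPolynomial.eval p.rep Φ = 0 from h0]
        simp
      · have := H (Projectivization.mk ℝ q hq0) (by
          rw [line, Set.mem_ofPred_eq, grad_dotProduct hΦ, ← h, hC.polar_smul_right, hq, mul_zero])
          hqp
        rw [three_le_intersectionMultiplicity_iff hΦ, ← h, hC.polar_smul_left] at this
        simpa [ht] using this.2.2
    · intro H q hq _
      rw [line, Set.mem_ofPred_eq, grad_dotProduct hΦ] at hq
      rw [three_le_intersectionMultiplicity_iff hΦ]
      exact ⟨h0, hq, H _ hq⟩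

theorem mk_mem_flexPoints_iff (hΦ : Φ.IsHomogeneous 3) {v : Fin 3 → ℝ} (hv : v ≠ 0) :
    Projectivization.mk ℝ v hv ∈ flexPoints Φ ↔
      IsFlexVector (fun v => MvPolynomial.eval v Φ) v := by
  obtain ⟨t, ht, h⟩ := exists_smul_eq_rep_mk hv
  rw [mem_flexPoints_iff hΦ, ← h, isFlexVector_real_smul_iff (isCubicForm_eval hΦ) ht]

theorem IsSmoothIrreducible.exists_linearlyEquivalent (hΦ : Φ.IsHomogeneous 3)
    (h : IsSmoothIrreducible Φ) :
    ∃ k, LinearlyEquivalent (fun v => MvPolynomial.eval v Φ) (flexForm k) := by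
  have hC := isCubicForm_eval hΦ
  refine hC.exists_linearlyEquivalent_flexForm (fun p hp h0 => ?_) fun a ha => ?_
  · by_contra! hq
    obtain ⟨t, ht, ht'⟩ := exists_smul_eq_rep_mk hp
    refine h.1 (Projectivization.mk ℝ p hp) ⟨(mk_mem_locus_iff hΦ hp).2 h0, ?_⟩
    rw [← dotProduct_eq_zero_iff]
    intro q
    rw [grad_dotProduct hΦ, ← ht', hC.polar_smul_left, hq, mul_zero]
  · obtain ⟨p, hp, hp'⟩ := Set.not_subset.1 (h.2 a ha)
    exact ⟨p.rep, hp, hp'⟩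

/-! ### The automorphism group and its action on the flexes. -/

variable {A : GL (Fin 3) ℝ} {k s : ℝ}

/-- A projective automorphism of the curve multiplies its equation by a nonzero constant. -/
theorem exists_eval_smul_eq_of_mem_projAut (hΦ : Φ.IsHomogeneous 3) (hs : s ≠ 0)
    (hA : ∀ v, MvPolynomial.eval (A • v) Φ = s * flexForm k v) {B : GL (Fin 3) ℝ}
    (hB : Matrix.ProjGenLinGroup.mk B ∈ projAut (locus Φ)) :
    ∃ c : ℝ, c ≠ 0 ∧ ∀ v, MvPolynomial.eval (B • v) Φ = c * MvPolynomial.eval v Φ := by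
  have hC := isCubicForm_eval hΦ
  have hzero (v : Fin 3 → ℝ) (hv : MvPolynomial.eval v Φ = 0) :
      MvPolynomial.eval (B • v) Φ = 0 := by
    by_cases hv0 : v = 0
    · subst hv0; simpa using hv
    have h1 := Set.smul_mem_smul_set (a := Matrix.ProjGenLinGroup.mk B)
      ((mk_mem_locus_iff hΦ hv0).2 hv)
    rw [show Matrix.ProjGenLinGroup.mk B • locus Φ = locus Φ from hB] at h1
    exact (mk_mem_locus_iff hΦ _).1 h1
  -- B only preserves a set of real points; vanishing of Φ ∘ B ∘ A on the normal form upgrades this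
  -- to proportional equations.
  obtain ⟨c, hc⟩ := IsCubicForm.eq_const_mul_flexForm (k := k) (hC.comp (B * A)) fun v hv => by
    rw [mul_smul]
    exact hzero _ (by rw [hA, hv, mul_zero])
  have hcB (v : Fin 3 → ℝ) : MvPolynomial.eval (B • v) Φ = c / s * MvPolynomial.eval v Φ := by
    have h1 := hc (A⁻¹ • v)
    have h2 := hA (A⁻¹ • v)
    rw [mul_smul, smul_inv_smul] at h1
    rw [smul_inv_smul] at h2
    rw [h1, h2]
    field_simp
  refine ⟨c / s, fun h0 => ?_, hcB⟩
  -- (0 : 0 : 1) is off the normal form, so the factor cannot be zero.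
  have h1 := hcB (B⁻¹ • A • ![0, 0, 1])
  rw [smul_inv_smul, hA, h0, zero_mul] at h1
  simp [flexForm, hs] at h1

theorem mk_mem_projAut (hΦ : Φ.IsHomogeneous 3) {B : GL (Fin 3) ℝ}
    (hB : ∀ v, MvPolynomial.eval (B • v) Φ = MvPolynomial.eval v Φ) :
    Matrix.ProjGenLinGroup.mk B ∈ projAut (locus Φ) := by
  rw [projAut, MulAction.mem_stabilizer_iff]
  ext p
  rw [Set.mem_smul_set_iff_inv_smul_mem, ← map_inv]
  induction p using Projectivization.ind with | _ v hv =>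
  rw [Projectivization.PGL.mk_smul_mk, mk_mem_locus_iff hΦ, mk_mem_locus_iff hΦ, ← hB,
    smul_inv_smul]

theorem smul_mem_flexPoints (hΦ : Φ.IsHomogeneous 3) (hs : s ≠ 0)
    (hA : ∀ v, MvPolynomial.eval (A • v) Φ = s * flexForm k v) {g : PGL(Fin 3, ℝ)}
    (hg : g ∈ projAut (locus Φ)) {p : ℙ ℝ (Fin 3 → ℝ)} (hp : p ∈ flexPoints Φ) :
    g • p ∈ flexPoints Φ := by
  induction g using Matrix.ProjGenLinGroup.induction_on with | _ B
  obtain ⟨c, hc, hcB⟩ := exists_eval_smul_eq_of_mem_projAut hΦ hs hA hg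
  induction p using Projectivization.ind with | _ v hv =>
  rw [mk_mem_flexPoints_iff hΦ] at hp
  rw [Projectivization.PGL.mk_smul_mk, mk_mem_flexPoints_iff hΦ]
  exact (isFlexVector_smul_iff hc hcB v).2 hp

/-- The images in the projective plane of the flex points of `u v (k m - u - v) = m³`. -/
def flexPoint (A : GL (Fin 3) ℝ) (i : Fin 3) : ℙ ℝ (Fin 3 → ℝ) :=
  .mk ℝ (A • flexVector i) ((smul_ne_zero_iff_ne A).2 (flexVector_ne_zero i))

theorem smul_flexPoint_eq_iff (A B : GL (Fin 3) ℝ) (i j : Fin 3) :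
    Matrix.ProjGenLinGroup.mk B • flexPoint A i = flexPoint A j ↔
      ∃ t : ℝ, (A⁻¹ * B * A) • flexVector i = t • flexVector j := by
  rw [flexPoint, flexPoint, Projectivization.PGL.mk_smul_mk, Projectivization.mk_eq_mk_iff']
  refine exists_congr fun t => ?_
  rw [mul_smul, mul_smul, inv_smul_eq_iff, smul_comm A t, eq_comm]

theorem flexPoint_injective (A : GL (Fin 3) ℝ) : Function.Injective (flexPoint A) := by
  intro i j h
  have := (smul_flexPoint_eq_iff A 1 i j).1 (by rw [map_one, one_smul, h])
  obtain ⟨t, ht⟩ := this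
  exact (flexVector_eq_of_smul_eq (by simpa using ht.symm)).symm

theorem range_flexPoint (hΦ : Φ.IsHomogeneous 3) (hs : s ≠ 0)
    (hA : ∀ v, MvPolynomial.eval (A • v) Φ = s * flexForm k v) :
    Set.range (flexPoint A) = flexPoints Φ := by
  ext p
  constructor
  · rintro ⟨i, rfl⟩
    rw [flexPoint, mk_mem_flexPoints_iff hΦ]
    exact (isFlexVector_smul_iff hs hA _).2 (isFlexVector_flexVector k i)
  · induction p using Projectivization.ind with | _ v hv =>
    intro h
    rw [mk_mem_flexPoints_iff hΦ, ← smul_inv_smul A v, isFlexVector_smul_iff hs hA] at h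
    obtain ⟨i, t, ht⟩ := h.exists_smul_flexVector
    refine ⟨i, ?_⟩
    symm
    rw [flexPoint, Projectivization.mk_eq_mk_iff']
    exact ⟨t, by rw [smul_comm, ht, smul_inv_smul]⟩

theorem eq_one_of_smul_flexPoint_eq (hΦ : Φ.IsHomogeneous 3) (hs : s ≠ 0)
    (hA : ∀ v, MvPolynomial.eval (A • v) Φ = s * flexForm k v) {g : PGL(Fin 3, ℝ)}
    (hg : g ∈ projAut (locus Φ)) (hfix : ∀ i, g • flexPoint A i = flexPoint A i) : g = 1 := by
  induction g using Matrix.ProjGenLinGroup.induction_on with | _ B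
  obtain ⟨c, hc, hcB⟩ := exists_eval_smul_eq_of_mem_projAut hΦ hs hA hg
  obtain ⟨t, ht, h⟩ := eq_smul_of_fixes_flexVector (k := k) (c := c) (A⁻¹ * B * A) (fun v => by
    apply mul_left_cancel₀ hs
    rw [← hA, mul_smul, mul_smul, smul_inv_smul, hcB, hA]
    ring) fun i => (smul_flexPoint_eq_iff A B i i).1 (hfix i)
  have hBv (v : Fin 3 → ℝ) : B • v = t • v := by
    have := h (A⁻¹ • v)
    rw [mul_smul, mul_smul, smul_inv_smul, smul_comm t] at this
    exact smul_left_cancel _ this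
  rw [← Matrix.ProjGenLinGroup.mk_scalar (Units.mk0 t ht)]
  congr 1
  apply Units.ext
  apply Matrix.ext_of_mulVec_single
  intro i
  refine (hBv (Pi.single i 1)).trans ?_
  ext j
  simp [Matrix.GeneralLinearGroup.scalar, Pi.single_apply]

theorem exists_mem_projAut_smul_flexPoint (hΦ : Φ.IsHomogeneous 3)
    (hA : ∀ v, MvPolynomial.eval (A • v) Φ = s * flexForm k v) (σ : Equiv.Perm (Fin 3)) :
    ∃ g ∈ projAut (locus Φ), ∀ i, g • flexPoint A i = flexPoint A (σ i) := by
  obtain ⟨B, hB, hBσ⟩ := exists_perm_flexVector k σ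
  refine ⟨.mk (A * B * A⁻¹), mk_mem_projAut hΦ fun v => ?_, fun i => ?_⟩
  · rw [mul_smul, mul_smul, hA, hB, ← hA, smul_inv_smul]
  · rw [smul_flexPoint_eq_iff]
    simpa [mul_assoc] using hBσ i

/-- The action of the automorphism group of a curve on an invariant set of points. -/
def projAutToPerm (Φ : MvPolynomial (Fin 3) ℝ) (F : Set (ℙ ℝ (Fin 3 → ℝ)))
    (hF : ∀ g ∈ projAut (locus Φ), ∀ p ∈ F, g • p ∈ F) : projAut (locus Φ) →* Equiv.Perm F :=
  letI : MulAction (projAut (locus Φ)) F :=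
    { smul := fun g p => ⟨(g : PGL(Fin 3, ℝ)) • (p : ℙ ℝ (Fin 3 → ℝ)), hF g g.2 p p.2⟩
      one_smul := fun p => Subtype.ext (one_smul _ (p : ℙ ℝ (Fin 3 → ℝ)))
      mul_smul := fun g h p => Subtype.ext
        (mul_smul (g : PGL(Fin 3, ℝ)) (h : PGL(Fin 3, ℝ)) (p : ℙ ℝ (Fin 3 → ℝ))) }
  MulAction.toPermHom _ _

end PlaneCurve

end

theorem mainTheorem3 (Φ : MvPolynomial (Fin 3) ℝ) (hΦ : Φ.IsHomogeneous 3)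
    (hC : PlaneCurve.IsSmoothIrreducible Φ) :
    (PlaneCurve.flexPoints Φ).ncard = 3 ∧
    Nat.card (PlaneCurve.projAut (PlaneCurve.locus Φ)) = 6 ∧
    (∃ f g : PlaneCurve.projAut (PlaneCurve.locus Φ), f * g ≠ g * f) ∧
    (∃ e : PlaneCurve.projAut (PlaneCurve.locus Φ) ≃* Equiv.Perm (PlaneCurve.flexPoints Φ),
      ∀ (g : PlaneCurve.projAut (PlaneCurve.locus Φ)) (p : PlaneCurve.flexPoints Φ),
        ((e g p : PlaneCurve.flexPoints Φ) : ℙ ℝ (Fin 3 → ℝ)) =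
          (g : PGL(Fin 3, ℝ)) • (p : ℙ ℝ (Fin 3 → ℝ))) ∧
    (∀ σ : Equiv.Perm (PlaneCurve.flexPoints Φ),
      ∃! g : PlaneCurve.projAut (PlaneCurve.locus Φ), ∀ p : PlaneCurve.flexPoints Φ,
        (g : PGL(Fin 3, ℝ)) • (p : ℙ ℝ (Fin 3 → ℝ)) =
          ((σ p : PlaneCurve.flexPoints Φ) : ℙ ℝ (Fin 3 → ℝ))) := by
  obtain ⟨k, A, s, hs, hA⟩ := PlaneCurve.IsSmoothIrreducible.exists_linearlyEquivalent hΦ hC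
  have hrange := PlaneCurve.range_flexPoint hΦ hs hA
  let ι : Fin 3 ≃ PlaneCurve.flexPoints Φ :=
    (Equiv.ofInjective _ (PlaneCurve.flexPoint_injective A)).trans (Equiv.setCongr hrange)
  have hι (i) : (ι i : ℙ ℝ (Fin 3 → ℝ)) = PlaneCurve.flexPoint A i := rfl
  let ρ := PlaneCurve.projAutToPerm Φ (PlaneCurve.flexPoints Φ)
    fun g hg p hp => PlaneCurve.smul_mem_flexPoints hΦ hs hA hg hp
  have hρ (g p) : (ρ g p : ℙ ℝ (Fin 3 → ℝ)) = (g : PGL(Fin 3, ℝ)) • (p : ℙ ℝ (Fin 3 → ℝ)) := rfl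
  have hinj : Function.Injective ρ := by
    rw [injective_iff_map_eq_one]
    intro g hg
    refine Subtype.ext (PlaneCurve.eq_one_of_smul_flexPoint_eq hΦ hs hA g.2 fun i => ?_)
    rw [← hι, ← hρ, hg]
    rfl
  have hsurj : Function.Surjective ρ := by
    intro σ
    obtain ⟨g, hg, hgσ⟩ := PlaneCurve.exists_mem_projAut_smul_flexPoint hΦ hA
      ((ι.trans σ).trans ι.symm)
    refine ⟨⟨g, hg⟩, Equiv.ext fun p => Subtype.ext ?_⟩
    obtain ⟨i, rfl⟩ := ι.surjective p
    rw [hρ, hι]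
    refine (hgσ i).trans ?_
    rw [← hι]
    simp
  let e := MulEquiv.ofBijective ρ ⟨hinj, hsurj⟩
  have he (g p) : (e g p : ℙ ℝ (Fin 3 → ℝ)) = (g : PGL(Fin 3, ℝ)) • (p : ℙ ℝ (Fin 3 → ℝ)) := rfl
  refine ⟨?_, ?_, ?_, ⟨e, he⟩, fun σ => ?_⟩
  · rw [← Nat.card_coe_set_eq, ← Nat.card_congr ι, Nat.card_fin]
  · rw [Nat.card_congr (e.toEquiv.trans ι.permCongr.symm), Nat.card_perm, Nat.card_fin]
    rfl
  -- Two transpositions of three letters that share one letter do not commute.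
  · let e' : PlaneCurve.projAut (PlaneCurve.locus Φ) ≃* Equiv.Perm (Fin 3) :=
      e.trans ι.permCongrHom.symm
    refine ⟨e'.symm (Equiv.swap 0 1), e'.symm (Equiv.swap 1 2), fun h => ?_⟩
    rw [← map_mul, ← map_mul, e'.symm.injective.eq_iff] at h
    revert h
    decide
  · refine ⟨e.symm σ, fun p => ?_, fun g hg => ?_⟩
    · simp only [← he, e.apply_symm_apply]
    · rw [MulEquiv.eq_symm_apply]
      exact Equiv.ext fun p => Subtype.ext (hg p)
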